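/- Let $k$ be a field and $G$ a finite group. Let $H=O_k(G)$ be the Hopf algebra of $k$-valued functions on $G$ (the dual of the group algebra $k[G]$), with basis $(e_g)_{g\in G}$ given by $e_g(h)=\delta_{g,h}$, coproduct $\Delta(e_g)=\sum_{h\in G}e_{gh^{-1}}\otimes e_h$, counit $\varepsilon(e_g)=\delta_{g,1}$ and antipode $S(e_g)=e_{g^{-1}}$. For a finite-dimensional Hopf algebra $H$ over $k$, let $t_H=\{t_x\mid x\in H\}$ be a copy of the vector space $H$, let $S(t_H)$ be its symmetric algebra, and let $x\mapsto t^{-1}_x$ be the unique linear map $H\to\operatorname{Frac}S(t_H)$ with $t_{x_1}t^{-1}_{x_2}=t^{-1}_{x_1}t_{x_2}=\varepsilon(x)1$ for all $x\in H$ (Sweedler notation). The generic base algebra $\mathcal B_H$ is the $k$-subalgebra of $\operatorname{Frac}S(t_H)$ generated by all elements $$\sigma(x,y)=t_{x_1}t_{y_1}t^{-1}_{x_2y_2},\qquad \sigma^{-1}(x,y)=t_{x_1y_1}t^{-1}_{x_2}t^{-1}_{y_2}\qquad(x,y\in H).$$ The generalized Noether problem (GNP) has a positive answer for $H$ if $\mathcal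 B_H$ is isomorphic, as a $k$-algebra, to a localization of a polynomial algebra over $k$ in finitely many variables. Noether's classical problem has a positive answer for $G$ and $k$ if the field of invariants $k(t_g\mid g\in G)^G$, where $t_g$ ($g\in G$) are indeterminates and $G$ acts by $k$-automorphisms with $h\cdot t_g=t_{hg}$, is a purely transcendental extension of $k$. Proposition 4.1 (GNP-NP). (a) Under the $k$-isomorphism $\operatorname{Frac}S(t_H)\cong k(t_g\mid g\in G)$, $t_{e_{g^{-1}}}\mapsto t_g$, with $H=O_k(G)$, one has $$\mathcal B_H=k[t_g\mid g\in G]^G\left[\frac{1}{\Theta_G^2}\right],$$ where $\Theta_G=\det(t_{gh^{-1}})_{g,h\in G}$ is Dedekind's group determinant. (b) If (GNP) has a positive answer for $H=O_k(G)$, then Noether's classical problem has a positive answer for $G$ and $k$. -/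

import Mathlib

open scoped TensorProduct

noncomputable section

namespace GenNoether

universe u v

/-! ### The fraction field of the symmetric algebra of a coalgebra and the maps `t`, `t⁻¹` -/

section Generic

variable (k : Type u) [Field k]

/-- The field of fractions `Frac S(t_C)` of the symmetric algebra of the vector space `C`. -/
abbrev FracSym (C : Type v) [AddCommGroup C] [Module k C] : Type (max u v) :=
  FractionRing (SymmetricAlgebra k C)

/-- The linear map `x ↦ t_x` from `C` to `Frac S(t_C)`. -/
def t (C : Type v) [AddCommGroup C] [Module k C] : C →ₗ[k] FracSym k C :=
  (Algebra.ofId (SymmetricAlgebra k C) (FracSym k C)).toLinearMap.restrictScalars k ∘ₗ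
    SymmetricAlgebra.ι k C

/-- A square matrix over `S` which specializes to the identity matrix under some ring
homomorphism to a nontrivial ring is invertible over the fraction field of `S`. -/
theorem isUnit_map_of_map_eq_one {S F R ι : Type*} [CommRing S] [Field F] [Algebra S F]
    [FaithfulSMul S F] [CommRing R] [Nontrivial R] [Fintype ι] [DecidableEq ι]
    (M : Matrix ι ι S) (ev : S →+* R) (h : M.map ev = 1) :
    IsUnit (M.map (algebraMap S F)) := by
  rw [Matrix.isUnit_iff_isUnit_det, isUnit_iff_ne_zero]
  have h1 : (M.map (algebraMap S F)).det = algebraMap S F M.det := by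
    rw [RingHom.map_det]; rfl
  rw [h1]
  intro h0
  have h2 : M.det = 0 := by
    apply FaithfulSMul.algebraMap_injective S F
    rw [h0, map_zero]
  have h3 : ev M.det = 1 := by
    rw [RingHom.map_det, RingHom.mapMatrix_apply, h, Matrix.det_one]
  rw [h2, map_zero] at h3
  exact zero_ne_one h3

/-- For a finite-dimensional coalgebra `C`, the map `t` is invertible for the convolution
product on `Hom(C, Frac S(t_C))`. -/
theorem isUnit_t (C : Type v) [AddCommGroup C] [Module k C] [Coalgebra k C]
    [FiniteDimensional k C] : IsUnit (WithConv.toConv (t k C)) := by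
  let b := Module.finBasis k C
  let S := SymmetricAlgebra k C
  let F := FracSym k C
  let ev : S →ₐ[k] k := SymmetricAlgebra.lift (Coalgebra.counit (R := k) (A := C))
  let c : Fin (Module.finrank k C) → C →ₗ[k] S := fun j =>
    Algebra.linearMap k S ∘ₗ b.coord j
  let L : Fin (Module.finrank k C) → C ⊗[k] C →ₗ[k] S := fun j =>
    LinearMap.mul' k S ∘ₗ TensorProduct.map (SymmetricAlgebra.ι k C) (c j)
  let R : Fin (Module.finrank k C) → C ⊗[k] C →ₗ[k] S := fun j =>
    LinearMap.mul' k S ∘ₗ TensorProduct.map (c j) (SymmetricAlgebra.ι k C)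
  have hexp : ∀ (u : C →ₗ[k] F) (y : C), u y = ∑ j, algebraMap S F (c j y) * u (b j) := by
    intro u y
    conv_lhs => rw [← b.sum_repr y, map_sum]
    refine Finset.sum_congr rfl fun j _ => ?_
    rw [map_smul, Algebra.smul_def, IsScalarTower.algebraMap_apply k S F]
    rfl
  have hL : ∀ (u : C →ₗ[k] F) (z : C ⊗[k] C),
      LinearMap.mul' k F (TensorProduct.map (t k C) u z) =
        ∑ j, algebraMap S F (L j z) * u (b j) := by
    intro u z
    induction z with
    | zero => simp
    | add x y hx hy => simp only [map_add, hx, hy, add_mul, Finset.sum_add_distrib]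
    | tmul x y =>
      simp only [L, LinearMap.comp_apply, TensorProduct.map_tmul, LinearMap.mul'_apply, map_mul]
      rw [hexp u y, Finset.mul_sum]
      refine Finset.sum_congr rfl fun j _ => ?_
      rw [mul_assoc]
      rfl
  have hR : ∀ (u : C →ₗ[k] F) (z : C ⊗[k] C),
      LinearMap.mul' k F (TensorProduct.map u (t k C) z) =
        ∑ j, algebraMap S F (R j z) * u (b j) := by
    intro u z
    induction z with
    | zero => simp
    | add x y hx hy => simp only [map_add, hx, hy, add_mul, Finset.sum_add_distrib]
    | tmul x y =>
      simp only [R, LinearMap.comp_apply, TensorProduct.map_tmul, LinearMap.mul'_apply, map_mul]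
      rw [hexp u x, Finset.sum_mul]
      refine Finset.sum_congr rfl fun j _ => ?_
      rw [mul_right_comm]
      rfl
  have hevc : ∀ j y, ev (c j y) = b.coord j y := fun j y => by
    simp [ev, c]
  have hevι : ∀ y, ev (SymmetricAlgebra.ι k C y) = Coalgebra.counit (R := k) y := fun y =>
    SymmetricAlgebra.lift_ι_apply _ y
  have hLev : ∀ j (z : C ⊗[k] C), ev (L j z) = b.coord j
      (TensorProduct.lid k C (LinearMap.rTensor C (Coalgebra.counit (R := k)) z)) := by
    intro j z
    induction z with
    | zero => simp
    | add x y hx hy => simp only [map_add, hx, hy]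
    | tmul x y =>
      simp only [L, LinearMap.comp_apply, TensorProduct.map_tmul, LinearMap.mul'_apply, map_mul,
        hevc, hevι, LinearMap.rTensor_tmul, TensorProduct.lid_tmul, map_smul, smul_eq_mul]
  have hRev : ∀ j (z : C ⊗[k] C), ev (R j z) = b.coord j
      (TensorProduct.rid k C (LinearMap.lTensor C (Coalgebra.counit (R := k)) z)) := by
    intro j z
    induction z with
    | zero => simp
    | add x y hx hy => simp only [map_add, hx, hy]
    | tmul x y =>
      simp only [R, LinearMap.comp_apply, TensorProduct.map_tmul, LinearMap.mul'_apply, map_mul,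
        hevc, hevι, LinearMap.lTensor_tmul, TensorProduct.rid_tmul, map_smul, smul_eq_mul, mul_comm]
  have key : ∀ (T : Fin (Module.finrank k C) → C ⊗[k] C →ₗ[k] S),
      (∀ j i, ev (T j (Coalgebra.comul (b i))) = b.coord j (b i)) →
      ∃ u : C →ₗ[k] F, ∀ x, ∑ j, algebraMap S F (T j (Coalgebra.comul x)) * u (b j) =
        algebraMap k F (Coalgebra.counit x) := by
    intro T hT
    let M : Matrix (Fin (Module.finrank k C)) (Fin (Module.finrank k C)) S :=
      Matrix.of fun i j => T j (Coalgebra.comul (b i))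
    have hM : IsUnit (M.map (algebraMap S F)) := by
      refine isUnit_map_of_map_eq_one M ev.toRingHom ?_
      ext i j
      have := hT j i
      simp only [Module.Basis.coord_apply, Module.Basis.repr_self, Finsupp.single_apply] at this
      simpa [M, Matrix.one_apply] using this
    let v : Fin (Module.finrank k C) → F := fun i => algebraMap k F (Coalgebra.counit (b i))
    refine ⟨b.constr k ((M.map (algebraMap S F))⁻¹.mulVec v), fun x => ?_⟩
    let l1 : C →ₗ[k] F := ∑ j, (LinearMap.mulRight k
      ((M.map (algebraMap S F))⁻¹.mulVec v j)) ∘ₗ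
        (Algebra.linearMap S F).restrictScalars k ∘ₗ T j ∘ₗ Coalgebra.comul
    let l2 : C →ₗ[k] F := Algebra.linearMap k F ∘ₗ Coalgebra.counit
    have hl : l1 = l2 := by
      refine b.ext fun i => ?_
      have h1 : (M.map (algebraMap S F)).mulVec ((M.map (algebraMap S F))⁻¹.mulVec v) i = v i := by
        rw [Matrix.mulVec_mulVec, Matrix.mul_nonsing_inv _
          ((Matrix.isUnit_iff_isUnit_det _).mp hM), Matrix.one_mulVec]
      calc l1 (b i) = (M.map (algebraMap S F)).mulVec
            ((M.map (algebraMap S F))⁻¹.mulVec v) i := by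
            simp [l1, Matrix.mulVec, dotProduct, M]
        _ = l2 (b i) := h1
    have := LinearMap.congr_fun hl x
    simpa [l1, l2] using this
  obtain ⟨u, hu⟩ := key L (fun j i => by rw [hLev, Coalgebra.rTensor_counit_comul]; simp)
  obtain ⟨w, hw⟩ := key R (fun j i => by rw [hRev, Coalgebra.lTensor_counit_comul]; simp)
  have h1 : WithConv.toConv (t k C) * WithConv.toConv u = 1 := by
    ext x
    exact (hL u _).trans (hu x)
  have h2 : WithConv.toConv w * WithConv.toConv (t k C) = 1 := by
    ext x
    exact (hR w _).trans (hw x)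
  exact isUnit_iff_exists_and_exists.mpr ⟨⟨_, h1⟩, ⟨_, h2⟩⟩

/-- The convolution inverse `x ↦ t⁻¹_x` of `t`, that is, the unique linear map
`C → Frac S(t_C)` with `t_{x₁} t⁻¹_{x₂} = t⁻¹_{x₁} t_{x₂} = ε(x) 1` for all `x`. -/
def tInv (C : Type v) [AddCommGroup C] [Module k C] [Coalgebra k C]
    [FiniteDimensional k C] : C →ₗ[k] FracSym k C :=
  WithConv.ofConv (↑((isUnit_t k C).unit⁻¹) : WithConv (C →ₗ[k] FracSym k C))

theorem t_mul_tInv (C : Type v) [AddCommGroup C] [Module k C] [Coalgebra k C]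
    [FiniteDimensional k C] {ι : Type*} (x : C) (r : Coalgebra.Repr k x ι) :
    ∑ i ∈ r.index, t k C (r.left i) * tInv k C (r.right i) =
      algebraMap k (FracSym k C) (Coalgebra.counit x) := by
  have h := congrArg (fun f : WithConv (C →ₗ[k] FracSym k C) => f x) (isUnit_t k C).mul_val_inv
  rw [Coalgebra.Repr.convMul_apply r] at h
  exact h

theorem tInv_mul_t (C : Type v) [AddCommGroup C] [Module k C] [Coalgebra k C]
    [FiniteDimensional k C] {ι : Type*} (x : C) (r : Coalgebra.Repr k x ι) :
    ∑ i ∈ r.index, tInv k C (r.left i) * t k C (r.right i) =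
      algebraMap k (FracSym k C) (Coalgebra.counit x) := by
  have h := congrArg (fun f : WithConv (C →ₗ[k] FracSym k C) => f x) (isUnit_t k C).val_inv_mul
  rw [Coalgebra.Repr.convMul_apply r] at h
  exact h

/-- The free commutative Hopf algebra `S(t_C)_Θ` generated by `C`, as an algebra: the subalgebra
of `Frac S(t_C)` generated by all `t_x` and `t⁻¹_x`. -/
def freeHopf (C : Type v) [AddCommGroup C] [Module k C] [Coalgebra k C]
    [FiniteDimensional k C] : Subalgebra k (FracSym k C) :=
  Algebra.adjoin k (Set.range (t k C) ∪ Set.range (tInv k C))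

variable (H : Type v) [Ring H] [HopfAlgebra k H] [FiniteDimensional k H]

/-- `σ(x, y) = t_{x₁} t_{y₁} t⁻¹_{x₂ y₂}`, written as the convolution product, on the tensor
product coalgebra `H ⊗ H`, of `x ⊗ y ↦ t_x t_y` and `x ⊗ y ↦ t⁻¹_{xy}`. -/
def sigma (x y : H) : FracSym k H :=
  (WithConv.toConv (LinearMap.mul' k (FracSym k H) ∘ₗ TensorProduct.map (t k H) (t k H)) *
    WithConv.toConv (tInv k H ∘ₗ LinearMap.mul' k H)) (x ⊗ₜ[k] y)

/-- `σ⁻¹(x, y) = t_{x₁ y₁} t⁻¹_{x₂} t⁻¹_{y₂}`, as a convolution product on `H ⊗ H`. -/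
def sigmaInv (x y : H) : FracSym k H :=
  (WithConv.toConv (t k H ∘ₗ LinearMap.mul' k H) *
    WithConv.toConv (LinearMap.mul' k (FracSym k H) ∘ₗ
      TensorProduct.map (tInv k H) (tInv k H))) (x ⊗ₜ[k] y)

/-- The generic base algebra `𝓑_H`: the algebra generated by all `σ(x, y)` and `σ⁻¹(x, y)`. -/
def baseAlgebra : Subalgebra k (FracSym k H) :=
  Algebra.adjoin k ({z | ∃ x y : H, z = sigma k H x y} ∪ {z | ∃ x y : H, z = sigmaInv k H x y})

theorem sigma_eq_sum {ι κ : Type*} (x y : H) (rx : Coalgebra.Repr k x ι)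
    (ry : Coalgebra.Repr k y κ) :
    sigma k H x y = ∑ i ∈ rx.index, ∑ j ∈ ry.index,
      t k H (rx.left i) * t k H (ry.left j) * tInv k H (rx.right i * ry.right j) := by
  simp [sigma, TensorProduct.comul_tmul, ← rx.eq, ← ry.eq, TensorProduct.sum_tmul,
    TensorProduct.tmul_sum, map_sum]
  rw [Finset.sum_comm]

theorem sigmaInv_eq_sum {ι κ : Type*} (x y : H) (rx : Coalgebra.Repr k x ι)
    (ry : Coalgebra.Repr k y κ) :
    sigmaInv k H x y = ∑ i ∈ rx.index, ∑ j ∈ ry.index,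
      t k H (rx.left i * ry.left j) * (tInv k H (rx.right i) * tInv k H (ry.right j)) := by
  simp [sigmaInv, TensorProduct.comul_tmul, ← rx.eq, ← ry.eq, TensorProduct.sum_tmul,
    TensorProduct.tmul_sum, map_sum]
  rw [Finset.sum_comm]

/-- `𝓑_H` is a subalgebra of `S(t_H)_Θ`. -/
theorem baseAlgebra_le_freeHopf : baseAlgebra k H ≤ freeHopf k H := by
  have ht : ∀ x, t k H x ∈ freeHopf k H := fun x =>
    Algebra.subset_adjoin (Or.inl ⟨x, rfl⟩)
  have hi : ∀ x, tInv k H x ∈ freeHopf k H := fun x =>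
    Algebra.subset_adjoin (Or.inr ⟨x, rfl⟩)
  refine Algebra.adjoin_le ?_
  rintro z (⟨x, y, rfl⟩ | ⟨x, y, rfl⟩)
  · rw [sigma_eq_sum k H x y (.arbitrary k x) (.arbitrary k y)]
    exact sum_mem fun i _ => sum_mem fun j _ => mul_mem (mul_mem (ht _) (ht _)) (hi _)
  · rw [sigmaInv_eq_sum k H x y (.arbitrary k x) (.arbitrary k y)]
    exact sum_mem fun i _ => sum_mem fun j _ => mul_mem (ht _) (mul_mem (hi _) (hi _))

/-- The generalized Noether problem has a positive answer for the finite-dimensional Hopf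
algebra `H`: `𝓑_H` is a localization of a polynomial algebra in finitely many variables. -/
def GNPPositive : Prop :=
  ∃ (n : ℕ) (M : Submonoid (MvPolynomial (Fin n) k)),
    Nonempty (Localization M ≃ₐ[k] baseAlgebra k H)

end Generic

/-! ### The Hopf algebra of functions on a finite group -/

/-- The algebra of `k`-valued functions on `G` (pointwise operations). It is a type synonym: the
coalgebra structure below is not the pointwise one that `G → k` carries in Mathlib. -/
def FunHopf (k : Type u) (G : Type v) : Type (max u v) := G → k

namespace FunHopf

variable (k : Type u) (G : Type v) [Field k]

instance : CommRing (FunHopf k G) := inferInstanceAs (CommRing (G → k))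
instance : Algebra k (FunHopf k G) := inferInstanceAs (Algebra k (G → k))

/-- Evaluation at `g`. -/
def ev (g : G) : FunHopf k G →ₗ[k] k := LinearMap.proj (R := k) (φ := fun _ : G => k) g

variable {G}

theorem ext_ev {x y : FunHopf k G} (h : ∀ g, ev k G g x = ev k G g y) : x = y := funext h

@[simp] theorem ev_mul (g : G) (x y : FunHopf k G) :
    ev k G g (x * y) = ev k G g x * ev k G g y := rfl

@[simp] theorem ev_one (g : G) : ev k G g (1 : FunHopf k G) = 1 := rfl

variable (G)

variable [Fintype G] [DecidableEq G]

instance : FiniteDimensional k (FunHopf k G) := inferInstanceAs (FiniteDimensional k (G → k))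

variable {G}

/-- The function `e_g`, equal to `1` at `g` and to `0` elsewhere. -/
def e (g : G) : FunHopf k G := (Pi.single g 1 : G → k)

variable (G)

/-- The basis `(e_g)` of the space of functions. -/
def basis : Module.Basis G k (FunHopf k G) := Pi.basisFun k G

variable {G}

@[simp] theorem basis_apply (g : G) : basis k G g = e k g := Pi.basisFun_apply k G g

@[simp] theorem ev_e (g h : G) : ev k G g (e k h) = if g = h then 1 else 0 := by
  change (Pi.single h 1 : G → k) g = _
  rw [Pi.single_apply]

theorem e_mul_e (g h : G) : e k g * e k h = if g = h then e k g else 0 := by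
  apply ext_ev
  intro a
  by_cases hgh : g = h
  · subst hgh; simp
  · simp only [ev_mul, ev_e, if_neg hgh, map_zero]
    split_ifs with h1 h2 <;> simp_all

theorem sum_e : ∑ g, e k g = (1 : FunHopf k G) := by
  apply ext_ev
  intro a
  simp [map_sum]

variable [Group G]

theorem sum_inv_e : ∑ g : G, e k g⁻¹ = (1 : FunHopf k G) := by
  rw [← sum_e]
  exact Fintype.sum_equiv (Equiv.inv G) _ _ fun _ => rfl

/-- The coalgebra structure dual to the algebra structure of `k[G]`:
`Δ(f) = ∑_{a,b} f(ab) e_a ⊗ e_b` and `ε(f) = f(1)`. -/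
instance : CoalgebraStruct k (FunHopf k G) where
  comul := ∑ a : G, ∑ b : G, (ev k G (a * b)).smulRight (e k a ⊗ₜ[k] e k b)
  counit := ev k G 1

theorem comul_apply (x : FunHopf k G) : Coalgebra.comul (R := k) x =
    ∑ a : G, ∑ b : G, ev k G (a * b) x • (e k a ⊗ₜ[k] e k b) := by
  simp [Coalgebra.comul]

theorem counit_apply (x : FunHopf k G) : Coalgebra.counit (R := k) x = ev k G 1 x := rfl

/-- `Δ(e_g) = ∑_h e_{gh⁻¹} ⊗ e_h`. -/
theorem comul_e (g : G) : Coalgebra.comul (R := k) (e k g) =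
    ∑ h : G, e k (g * h⁻¹) ⊗ₜ[k] e k h := by
  rw [comul_apply, Finset.sum_comm]
  refine Finset.sum_congr rfl fun h _ => ?_
  rw [Finset.sum_eq_single (g * h⁻¹)]
  · simp
  · intro a _ ha
    rw [ev_e, if_neg (fun hh => ha (eq_mul_inv_of_mul_eq hh)), zero_smul]
  · simp

theorem counit_e (g : G) : Coalgebra.counit (R := k) (e k g) = if g = 1 then 1 else 0 := by
  rw [counit_apply, ev_e]
  simp [eq_comm]

instance : Coalgebra k (FunHopf k G) where
  coassoc := by
    refine (basis k G).ext fun g => ?_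
    simp only [LinearMap.comp_apply, basis_apply, comul_e, map_sum, LinearMap.rTensor_tmul,
      LinearMap.lTensor_tmul, TensorProduct.sum_tmul, TensorProduct.tmul_sum,
      LinearEquiv.coe_coe, TensorProduct.assoc_tmul]
    conv_rhs => rw [Finset.sum_comm]
    refine Finset.sum_congr rfl fun a _ => ?_
    refine Fintype.sum_equiv (Equiv.mulRight a) _ _ fun h => ?_
    simp [mul_assoc]
  rTensor_counit_comp_comul := by
    refine (basis k G).ext fun g => ?_
    simp only [LinearMap.comp_apply, basis_apply, comul_e, map_sum, LinearMap.rTensor_tmul,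
      counit_e, TensorProduct.mk_apply]
    rw [Finset.sum_eq_single g]
    · simp
    · intro h _ hh
      rw [if_neg (fun h1 => hh (mul_inv_eq_one.mp h1).symm), TensorProduct.zero_tmul]
    · simp
  lTensor_counit_comp_comul := by
    refine (basis k G).ext fun g => ?_
    simp only [LinearMap.comp_apply, basis_apply, comul_e, map_sum, LinearMap.lTensor_tmul,
      counit_e, TensorProduct.mk_apply, LinearMap.flip_apply]
    rw [Finset.sum_eq_single 1]
    · simp
    · intro h _ hh
      rw [if_neg hh, TensorProduct.tmul_zero]
    · simp

instance : Bialgebra k (FunHopf k G) :=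
  Bialgebra.mk' k (FunHopf k G) (by simp [counit_apply]) (by simp [counit_apply])
    (by
      simp only [comul_apply, ev_one, one_smul, ← TensorProduct.tmul_sum,
        ← TensorProduct.sum_tmul, sum_e]
      rfl)
    (by
      intro x y
      simp only [comul_apply, Finset.sum_mul, Finset.mul_sum, smul_mul_smul_comm,
        Algebra.TensorProduct.tmul_mul_tmul, e_mul_e, ev_mul]
      refine Finset.sum_congr rfl fun a _ => Finset.sum_congr rfl fun b _ => ?_
      rw [Finset.sum_eq_single a, Finset.sum_eq_single b]
      · simp
      · intro b' _ hb
        simp [hb]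
      · simp
      · intro a' _ ha
        simp [ha]
      · simp)

/-- The antipode is `S(f)(g) = f(g⁻¹)`. -/
instance : HopfAlgebra k (FunHopf k G) where
  antipode := (basis k G).constr k fun g => e k g⁻¹
  mul_antipode_rTensor_comul := by
    refine (basis k G).ext fun g => ?_
    have hS : ∀ h : G, (basis k G).constr k (fun g => e k g⁻¹) (e k h) = e k h⁻¹ := fun h => by
      rw [← basis_apply, Module.Basis.constr_basis]
    simp only [LinearMap.comp_apply, basis_apply, comul_e, map_sum, LinearMap.rTensor_tmul, hS,
      LinearMap.mul'_apply, e_mul_e, counit_e, Algebra.linearMap_apply]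
    by_cases hg : g = 1
    · subst hg
      simp [sum_e]
    · simp [hg]
  mul_antipode_lTensor_comul := by
    refine (basis k G).ext fun g => ?_
    have hS : ∀ h : G, (basis k G).constr k (fun g => e k g⁻¹) (e k h) = e k h⁻¹ := fun h => by
      rw [← basis_apply, Module.Basis.constr_basis]
    simp only [LinearMap.comp_apply, basis_apply, comul_e, map_sum, LinearMap.lTensor_tmul, hS,
      LinearMap.mul'_apply, e_mul_e, counit_e, Algebra.linearMap_apply]
    by_cases hg : g = 1
    · subst hg
      simp [sum_inv_e]
    · simp [hg]

theorem antipode_e (g : G) : HopfAlgebra.antipode k (e k g) = e k g⁻¹ := by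
  change (basis k G).constr k _ (e k g) = _
  rw [← basis_apply, Module.Basis.constr_basis]

end FunHopf

/-! ### Noether's problem -/

section Noether

variable (k : Type u) [Field k] (G : Type v)

/-- The purely transcendental extension `k(t_g | g ∈ G)`. -/
abbrev RatFun : Type (max u v) := FractionRing (MvPolynomial G k)

/-- The indeterminate `t_g`. -/
def tvar (g : G) : RatFun k G := algebraMap (MvPolynomial G k) (RatFun k G) (MvPolynomial.X g)

theorem algEquiv_ext {f f' : RatFun k G ≃ₐ[k] RatFun k G}
    (h : ∀ g, f (tvar k G g) = f' (tvar k G g)) : f = f' := by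
  have h1 : (f : RatFun k G →ₐ[k] RatFun k G).comp
        (Algebra.algHom k (MvPolynomial G k) (RatFun k G)) =
      (f' : RatFun k G →ₐ[k] RatFun k G).comp
        (Algebra.algHom k (MvPolynomial G k) (RatFun k G)) :=
    MvPolynomial.algHom_ext fun g => h g
  ext x
  obtain ⟨p, q, -, rfl⟩ := IsFractionRing.div_surjective (MvPolynomial G k) x
  have hp := DFunLike.congr_fun h1 p
  have hq := DFunLike.congr_fun h1 q
  change f (algebraMap _ _ p) = f' (algebraMap _ _ p) at hp
  change f (algebraMap _ _ q) = f' (algebraMap _ _ q) at hq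
  rw [map_div₀, map_div₀, hp, hq]

variable [Group G]

/-- The action of `G` on `k(t_g | g ∈ G)` by `k`-automorphisms with `h · t_g = t_{hg}`. -/
def noetherAction : G →* (RatFun k G ≃ₐ[k] RatFun k G) where
  toFun h := IsFractionRing.algEquivOfAlgEquiv
    (MvPolynomial.renameEquiv k (Equiv.mulLeft h))
  map_one' := by
    refine algEquiv_ext k G fun g => ?_
    simp [tvar]
  map_mul' a b := by
    refine algEquiv_ext k G fun g => ?_
    simp [tvar, mul_assoc]

theorem noetherAction_tvar (h g : G) : noetherAction k G h (tvar k G g) = tvar k G (h * g) := by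
  simp [noetherAction, tvar]

/-- The field of invariants `k(t_g | g ∈ G)^G`. -/
def noetherField : IntermediateField k (RatFun k G) :=
  IntermediateField.fixedField (noetherAction k G).range

/-- A field extension `L/k` is purely transcendental if it is generated, as a field extension,
by an algebraically independent set. -/
def IsPurelyTranscendental (L : Type*) [Field L] [Algebra k L] : Prop :=
  ∃ s : Set L, AlgebraicIndependent k ((↑) : s → L) ∧ IntermediateField.adjoin k s = ⊤

/-- Noether's classical problem has a positive answer for `G` and `k`. -/
def NoetherPositive : Prop := IsPurelyTranscendental k (noetherField k G)

/-- Dedekind's group determinant `Θ_G = det (t_{gh⁻¹})_{g,h}`, a polynomial. -/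
def groupDet [Fintype G] [DecidableEq G] : MvPolynomial G k :=
  (Matrix.of fun g h : G => (MvPolynomial.X (g * h⁻¹) : MvPolynomial G k)).det

theorem groupDet_ne_zero [Fintype G] [DecidableEq G] : groupDet k G ≠ 0 := by
  intro h0
  have h1 : MvPolynomial.eval (fun g : G => if g = 1 then (1 : k) else 0) (groupDet k G) = 1 := by
    rw [groupDet, RingHom.map_det]
    convert Matrix.det_one (n := G) (R := k) using 2
    ext g h
    simp [Matrix.one_apply, mul_inv_eq_one]
  rw [h0, map_zero] at h1
  exact zero_ne_one h1

/-- The algebra `k[t_g | g ∈ G]^G` of invariant polynomials. -/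
def invPoly : Subalgebra k (MvPolynomial G k) where
  carrier := {P | ∀ h : G, MvPolynomial.rename (fun g => h * g) P = P}
  mul_mem' ha hb h := by rw [map_mul, ha h, hb h]
  add_mem' ha hb h := by rw [map_add, ha h, hb h]
  algebraMap_mem' r h := by simp

theorem groupDet_sq_mem_invPoly [Fintype G] [DecidableEq G] :
    groupDet k G ^ 2 ∈ invPoly k G := by
  intro h
  have h1 : MvPolynomial.rename (fun g => h * g) (groupDet k G) =
      ((Matrix.of fun g h : G => (MvPolynomial.X (g * h⁻¹) : MvPolynomial G k)).submatrix
        (Equiv.mulLeft h) id).det := by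
    rw [groupDet, AlgHom.map_det]
    congr 1
    ext g g'
    simp [mul_assoc]
  rw [map_pow, h1, Matrix.det_permute, mul_pow, ← groupDet]
  rcases Int.units_eq_one_or (Equiv.Perm.sign (Equiv.mulLeft h)) with hs | hs <;> simp [hs]

/-- The localization `k[t_g | g ∈ G]^G [1/Θ_G²]`, as a subalgebra of `k(t_g | g ∈ G)`. -/
def invPolyLoc [Fintype G] [DecidableEq G] : Subalgebra k (RatFun k G) :=
  Algebra.adjoin k ((algebraMap (MvPolynomial G k) (RatFun k G)) '' (invPoly k G) ∪
    {(algebraMap (MvPolynomial G k) (RatFun k G) (groupDet k G ^ 2))⁻¹})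

end Noether

end GenNoether

end

/-! Write `T g` for the indeterminate `t_g` and `u g` for the image of `t⁻¹_{e_g}` in `k(t_g | g ∈
G)`. Convolution inverseness reads `∑ a, T (a * g⁻¹) * u a = δ_{g,1}`, which says that two `G × G`
matrices are inverse to each other. Let `A = k[T g, u g]` (`hopfImage`) and let `B` (`baseImage`) be
the image of the generic base algebra. Both sides of (a) are shown to equal the intersection of `A`
with the field of `G`-invariants.

For `B` this is `baseImage_eq_inf`. The generators of `B` are sums over `G`-orbits, hence invariant,
since `G` translates the index of `u` as it does that of `T`. Conversely, `T g * T g'` is a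
combination of the `T c` with cocycle values as coefficients, and this makes `A` the `B`-span of the
`T g` (`hopfImage_le_span`). If `x = ∑ b_g T g` is invariant, then `x = ∑ b_g T (a * g)` for every
`a`; weighting by `u a` and summing over `a` gives `(∑ u) x = b_1`, hence `x = (∑ T) b_1 ∈ B`.

For `k[t_g]^G[1/Θ²]` this is `invPolyLoc_eq_inf`. Cramer's rule shows that `A = k[t_g][1/Θ]`, and
`Θ` is invariant up to sign.

For (b), multiplying by the norm of a denominator shows that every invariant rational function is a
quotient of elements of `B`. If `B` is a localization of a polynomial algebra, the images of the
variables therefore generate the field of invariants and are algebraically independent. -/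

namespace GenNoether

universe u v

noncomputable section

/-! ### Convolution inverses on a finite group, as inverse matrices -/

section ConvInverse

variable {K G : Type*} [CommRing K] [Group G] [Fintype G] [DecidableEq G] {T u : G → K}

theorem sum_mul_translate_right (h : ∀ g, ∑ a, T (a * g⁻¹) * u a = if g = 1 then 1 else 0)
    (g g' : G) : ∑ a, T (a * g⁻¹) * u (a * g'⁻¹) = if g = g' then 1 else 0 := by
  have := h (g * g'⁻¹)
  simp only [mul_inv_eq_one] at this
  rw [← this]
  exact Fintype.sum_equiv (Equiv.mulRight g'⁻¹) _ _ fun a => by simp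

theorem mul_eq_one_of_convInverse
    (h : ∀ g, ∑ a, T (a * g⁻¹) * u a = if g = 1 then 1 else 0) :
    (Matrix.of fun g a : G => T (a * g⁻¹)) * (Matrix.of fun a g : G => u (a * g⁻¹)) = 1 := by
  ext g g'
  rw [Matrix.mul_apply, Matrix.one_apply]
  exact sum_mul_translate_right h g g'

/-- A one-sided inverse of a square matrix over a commutative ring is two-sided; this is the first
row of the product in the other order. It replaces right translates of `T` by left ones, which
matters when `G` is not abelian. -/
theorem sum_mul_left_of_convInverse
    (h : ∀ g, ∑ a, T (a * g⁻¹) * u a = if g = 1 then 1 else 0) (g : G) :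
    ∑ a, T (g * a) * u a = if g = 1 then 1 else 0 := by
  have h0 := mul_eq_one_comm.mp (mul_eq_one_of_convInverse h)
  have h1 := congrFun (congrFun h0 1) g
  rw [Matrix.mul_apply, Matrix.one_apply] at h1
  simp only [Matrix.of_apply, one_mul] at h1
  simp only [eq_comm (a := g)]
  rw [← h1]
  exact Fintype.sum_equiv (Equiv.inv G) _ _ fun a => by simp [mul_comm]

theorem convInverse_unique (h : ∀ g, ∑ a, T (a * g⁻¹) * u a = if g = 1 then 1 else 0)
    {v : G → K} (hv : ∀ g, ∑ a, T (a * g⁻¹) * v a = if g = 1 then 1 else 0) : v = u := by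
  have e : (Matrix.of fun g a : G => T (a * g⁻¹)).mulVec v =
      (Matrix.of fun g a : G => T (a * g⁻¹)).mulVec u := by
    ext g
    exact (hv g).trans (h g).symm
  have h1 := mul_eq_one_comm.mp (mul_eq_one_of_convInverse h)
  have e2 := congrArg (Matrix.mulVec (Matrix.of fun a g : G => u (a * g⁻¹))) e
  simpa only [Matrix.mulVec_mulVec, h1, Matrix.one_mulVec] using e2

/-- Adding the defining relations over all `g` decouples the two sums. In Hopf terms this is `t_1
t⁻¹_1 = 1`, because `1 = ∑ e_g` is grouplike. -/
theorem sum_mul_sum_of_convInverse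
    (h : ∀ g, ∑ a, T (a * g⁻¹) * u a = if g = 1 then 1 else 0) :
    (∑ g, T g) * ∑ g, u g = 1 := by
  have h1 : ∑ g : G, ∑ a, T (a * g⁻¹) * u a = 1 := by simp [h]
  rw [← h1, Finset.sum_comm, Finset.mul_sum]
  refine Finset.sum_congr rfl fun a _ => ?_
  rw [← Finset.sum_mul]
  congr 1
  exact Fintype.sum_equiv ((Equiv.inv G).trans (Equiv.mulRight a)) _ _ fun b => by simp

/-- This is `t_x t_y = σ(x₁, y₁) t_{x₂ y₂}` in coordinates: the inner coefficient will be a value of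
`σ`. It comes from inserting a delta function at `d = 1`. -/
theorem mul_eq_sum_cocycle (h : ∀ g, ∑ a, T (a * g⁻¹) * u a = if g = 1 then 1 else 0)
    (g g' : G) :
    T g * T g' = ∑ c, (∑ a, T (a * (g⁻¹ * c)⁻¹) * T (a * (g'⁻¹ * c)⁻¹) * u a) * T c := by
  calc T g * T g' = ∑ d, T (d * g) * T (d * g') * ∑ a, T (d⁻¹ * a) * u a := by
        simp [sum_mul_left_of_convInverse h]
    _ = ∑ a, ∑ d, T (d * g) * T (d * g') * (T (d⁻¹ * a) * u a) := by
        simp only [Finset.mul_sum]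
        exact Finset.sum_comm
    _ = ∑ a, ∑ c, T (a * (g⁻¹ * c)⁻¹) * T (a * (g'⁻¹ * c)⁻¹) * u a * T c := by
        refine Finset.sum_congr rfl fun a _ => ?_
        -- The substitution is `c = d⁻¹ * a`.
        refine Fintype.sum_equiv ((Equiv.inv G).trans (Equiv.mulRight a)) _ _ fun d => ?_
        simp only [Equiv.trans_apply, Equiv.inv_apply, Equiv.coe_mulRight, mul_inv_rev, inv_inv,
          mul_assoc, mul_inv_cancel_left]
        ring
    _ = _ := by
        rw [Finset.sum_comm]
        simp only [Finset.sum_mul]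

/-- The inner sum over `d` will be a value of `σ⁻¹`. Summing over `b` first cancels one factor `u`
against `T` and forces `d * c = g`, after which only `∑ d, T d * u g` is left. -/
theorem sum_mul_eq_sum_cocycleInv
    (h : ∀ g, ∑ a, T (a * g⁻¹) * u a = if g = 1 then 1 else 0) (g : G) :
    (∑ a, T a) * u g =
      ∑ c, ∑ b, (∑ d, T d * (u (d * b⁻¹) * u (d * c))) * T (g * c⁻¹ * b⁻¹) := by
  have h1 : ∀ c d : G, ∑ b, u (d * b⁻¹) * T (g * c⁻¹ * b⁻¹) = if d * c = g then 1 else 0 := by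
    intro c d
    have h2 := sum_mul_left_of_convInverse h (g * c⁻¹ * d⁻¹)
    have h3 : g * c⁻¹ * d⁻¹ = 1 ↔ d * c = g := by
      rw [mul_inv_eq_one, mul_inv_eq_iff_eq_mul, eq_comm]
    simp only [h3] at h2
    rw [← h2]
    exact Fintype.sum_equiv ((Equiv.inv G).trans (Equiv.mulLeft d)) _ _ fun b => by
      simp [mul_comm, mul_assoc]
  symm
  calc _ = ∑ c, ∑ d, T d * u (d * c) * ∑ b, u (d * b⁻¹) * T (g * c⁻¹ * b⁻¹) := by
        refine Finset.sum_congr rfl fun c _ => ?_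
        simp only [Finset.sum_mul, Finset.mul_sum]
        rw [Finset.sum_comm]
        exact Finset.sum_congr rfl fun d _ => Finset.sum_congr rfl fun b _ => by ring
    _ = ∑ d, ∑ c, T d * u (d * c) * if d * c = g then 1 else 0 := by
        rw [Finset.sum_comm]
        simp only [h1]
    _ = ∑ d, T d * u g := by
        refine Finset.sum_congr rfl fun d _ => ?_
        rw [Finset.sum_eq_single (d⁻¹ * g)]
        · simp
        · intro c _ hc
          rw [if_neg fun hh => hc (eq_inv_mul_of_mul_eq hh), mul_zero]
        · simp
    _ = _ := by rw [Finset.sum_mul]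

end ConvInverse

/-! ### The generators of the base algebra in the coordinates `t_g` -/

section Transfer

variable (k : Type u) [Field k] (G : Type v) [Fintype G] [DecidableEq G] [Group G]

/-- The identification of `S(t_H)` with `k[t_g | g ∈ G]` sending `t_{e_{g⁻¹}}` to `t_g`. -/
def symEquiv : SymmetricAlgebra k (FunHopf k G) ≃ₐ[k] MvPolynomial G k :=
  SymmetricAlgebra.equivMvPolynomial ((FunHopf.basis k G).reindex (Equiv.inv G))

/-- The identification of `Frac S(t_H)` with `k(t_g | g ∈ G)` sending `t_{e_{g⁻¹}}` to `t_g`. -/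
def fracEquiv : FracSym k (FunHopf k G) ≃ₐ[k] RatFun k G :=
  IsFractionRing.algEquivOfAlgEquiv (symEquiv k G)

theorem fracEquiv_t_e (g : G) :
    fracEquiv k G (t k (FunHopf k G) (FunHopf.e k g)) = tvar k G g⁻¹ := by
  have h : symEquiv k G (SymmetricAlgebra.ι k _ (FunHopf.e k g)) = MvPolynomial.X g⁻¹ := by
    have := SymmetricAlgebra.equivMvPolynomial_ι_apply
      ((FunHopf.basis k G).reindex (Equiv.inv G)) g⁻¹
    simpa [symEquiv] using this
  rw [tvar, ← h]
  exact IsFractionRing.algEquivOfAlgEquiv_algebraMap _ _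

/-- The image in `k(t_g | g ∈ G)` of `t⁻¹_{e_g}`. -/
def uvar (g : G) : RatFun k G := fracEquiv k G (tInv k (FunHopf k G) (FunHopf.e k g))

variable {G} in
/-- `Δ(e_g) = ∑_h e_{gh⁻¹} ⊗ e_h` as a representation of the coproduct. -/
def reprE (g : G) : Coalgebra.Repr k (FunHopf.e k g) G where
  index := Finset.univ
  left h := FunHopf.e k (g * h⁻¹)
  right h := FunHopf.e k h
  eq := (FunHopf.comul_e k g).symm

theorem tvar_uvar (g : G) :
    ∑ a, tvar k G (a * g⁻¹) * uvar k G a = if g = 1 then 1 else 0 := by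
  have h := congrArg (fracEquiv k G) (t_mul_tInv k (FunHopf k G) (FunHopf.e k g) (reprE k g))
  simp only [reprE, map_sum, map_mul, fracEquiv_t_e, FunHopf.counit_e, AlgEquiv.commutes] at h
  simp only [mul_inv_rev, inv_inv] at h
  simp only [uvar]
  rw [h]
  split_ifs <;> simp

theorem fracEquiv_sigma_e (g h : G) :
    fracEquiv k G (sigma k (FunHopf k G) (FunHopf.e k g) (FunHopf.e k h)) =
      ∑ a, tvar k G (a * g⁻¹) * tvar k G (a * h⁻¹) * uvar k G a := by
  rw [sigma_eq_sum k _ _ _ (reprE k g) (reprE k h)]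
  simp only [reprE, map_sum, map_mul, fracEquiv_t_e, FunHopf.e_mul_e]
  refine Finset.sum_congr rfl fun a _ => ?_
  -- The `e_g` are orthogonal idempotents, so the double sum collapses to its diagonal.
  rw [Finset.sum_eq_single a]
  · simp [uvar]
  · intro b _ hb
    simp [hb.symm]
  · simp

theorem fracEquiv_sigmaInv_e (g h : G) :
    fracEquiv k G (sigmaInv k (FunHopf k G) (FunHopf.e k g) (FunHopf.e k h)) =
      ∑ c, tvar k G c * (uvar k G (c * g) * uvar k G (c * h)) := by
  rw [sigmaInv_eq_sum k _ _ _ (reprE k g) (reprE k h)]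
  simp only [reprE, map_sum, map_mul, FunHopf.e_mul_e]
  -- With `c = a * g⁻¹`, orthogonality of the `e_g` leaves only `b = c * h`.
  refine Fintype.sum_equiv (Equiv.mulRight g⁻¹) _ _ fun a => ?_
  have key : ∀ b : G, g * a⁻¹ = h * b⁻¹ ↔ b = a * g⁻¹ * h := by
    intro b
    constructor
    · intro hh
      have h1 : g * a⁻¹ * b = h := eq_mul_inv_iff_mul_eq.mp hh
      rw [← h1]
      group
    · rintro rfl
      group
  rw [Finset.sum_eq_single (a * g⁻¹ * h)]
  · rw [if_pos ((key _).mpr rfl), fracEquiv_t_e]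
    simp [uvar]
  · intro b _ hb
    rw [if_neg (fun hh => hb ((key b).mp hh))]
    simp
  · simp

end Transfer

/-! ### The base algebra as the invariants in `S(t_H)_Θ` -/

section BaseAlgebra

variable (k : Type u) [Field k] (G : Type v) [Fintype G] [DecidableEq G] [Group G]

/-- Applying `h` to the defining relations shows that `c ↦ h · u (h⁻¹ * c)` is again a convolution
inverse of `T`, so uniqueness applies. -/
theorem noetherAction_uvar (h g : G) : noetherAction k G h (uvar k G g) = uvar k G (h * g) := by
  have h1 : (fun c => noetherAction k G h (uvar k G (h⁻¹ * c))) = uvar k G := by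
    refine convInverse_unique (tvar_uvar k G) fun g => ?_
    have h2 := congrArg (noetherAction k G h) (tvar_uvar k G g)
    rw [map_sum] at h2
    simp only [map_mul, noetherAction_tvar] at h2
    have h3 : noetherAction k G h (if g = 1 then 1 else 0) = if g = 1 then 1 else 0 := by
      split_ifs <;> simp
    rw [← h3, ← h2]
    exact Fintype.sum_equiv (Equiv.mulLeft h⁻¹) _ _ fun c => by simp [mul_assoc]
  rw [← congrFun h1 (h * g), inv_mul_cancel_left]

/-- The image of the generic base algebra in `k(t_g | g ∈ G)`. -/
def baseImage : Subalgebra k (RatFun k G) :=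
  (baseAlgebra k (FunHopf k G)).map (fracEquiv k G : _ →ₐ[k] RatFun k G)

/-- The image of `S(t_H)_Θ` in `k(t_g | g ∈ G)`. -/
def hopfImage : Subalgebra k (RatFun k G) :=
  Algebra.adjoin k (Set.range (tvar k G) ∪ Set.range (uvar k G))

variable {G} in
theorem tvar_mem_hopfImage (g : G) : tvar k G g ∈ hopfImage k G :=
  Algebra.subset_adjoin (Or.inl ⟨g, rfl⟩)

variable {G} in
theorem uvar_mem_hopfImage (g : G) : uvar k G g ∈ hopfImage k G :=
  Algebra.subset_adjoin (Or.inr ⟨g, rfl⟩)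

omit [Group G] in
/-- A linear map on `H ⊗ H` takes values in a subspace as soon as its values on the
`e_g ⊗ e_h` lie in it. -/
theorem map_tmul_mem {V : Type*} [AddCommGroup V] [Module k V]
    (f : FunHopf k G ⊗[k] FunHopf k G →ₗ[k] V) (W : Submodule k V)
    (hf : ∀ g h : G, f (FunHopf.e k g ⊗ₜ FunHopf.e k h) ∈ W) (x y : FunHopf k G) :
    f (x ⊗ₜ y) ∈ W := by
  have : LinearMap.range f ≤ W := by
    rw [LinearMap.range_eq_map, ← ((FunHopf.basis k G).tensorProduct (FunHopf.basis k G)).span_eq,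
      Submodule.map_span, Submodule.span_le]
    rintro _ ⟨_, ⟨⟨g, h⟩, rfl⟩, rfl⟩
    simpa using hf g h
  exact this ⟨_, rfl⟩

/-- By bilinearity in `x` and `y`, the values of `σ` and `σ⁻¹` on basis vectors control all
generators. -/
theorem baseImage_le {S : Subalgebra k (RatFun k G)}
    (h1 : ∀ g h : G, ∑ a, tvar k G (a * g⁻¹) * tvar k G (a * h⁻¹) * uvar k G a ∈ S)
    (h2 : ∀ g h : G, ∑ c, tvar k G c * (uvar k G (c * g) * uvar k G (c * h)) ∈ S) :
    baseImage k G ≤ S := by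
  rw [baseImage, Subalgebra.map_le, baseAlgebra, Algebra.adjoin_le_iff]
  rintro z (⟨x, y, rfl⟩ | ⟨x, y, rfl⟩)
  · refine map_tmul_mem k G (V := FracSym k (FunHopf k G)) _
      (Subalgebra.toSubmodule (S.comap (fracEquiv k G : _ →ₐ[k] RatFun k G))) (fun g h => ?_) x y
    have := h1 g h
    rw [← fracEquiv_sigma_e] at this
    exact this
  · refine map_tmul_mem k G (V := FracSym k (FunHopf k G)) _
      (Subalgebra.toSubmodule (S.comap (fracEquiv k G : _ →ₐ[k] RatFun k G))) (fun g h => ?_) x y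
    have := h2 g h
    rw [← fracEquiv_sigmaInv_e] at this
    exact this

theorem baseImage_le_hopfImage : baseImage k G ≤ hopfImage k G :=
  baseImage_le k G
    (fun _ _ => sum_mem fun _ _ => mul_mem (mul_mem (tvar_mem_hopfImage k _)
      (tvar_mem_hopfImage k _)) (uvar_mem_hopfImage k _))
    (fun _ _ => sum_mem fun _ _ => mul_mem (tvar_mem_hopfImage k _)
      (mul_mem (uvar_mem_hopfImage k _) (uvar_mem_hopfImage k _)))

omit [Fintype G] [DecidableEq G] in
variable {k G} in
theorem mem_noetherField {x : RatFun k G} :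
    x ∈ noetherField k G ↔ ∀ h : G, noetherAction k G h x = x := by
  simp [noetherField, IntermediateField.mem_fixedField_iff]

theorem baseImage_le_noetherField : baseImage k G ≤ (noetherField k G).toSubalgebra := by
  refine baseImage_le k G (fun g h => ?_) (fun g h => ?_)
  · refine mem_noetherField.mpr fun b => ?_
    simp only [map_sum, map_mul, noetherAction_tvar, noetherAction_uvar]
    exact Fintype.sum_equiv (Equiv.mulLeft b) _ _ fun a => by simp [mul_assoc]
  · refine mem_noetherField.mpr fun b => ?_
    simp only [map_sum, map_mul, noetherAction_tvar, noetherAction_uvar]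
    exact Fintype.sum_equiv (Equiv.mulLeft b) _ _ fun a => by simp [mul_assoc]

theorem sigma_mem_baseImage (g h : G) :
    ∑ a, tvar k G (a * g⁻¹) * tvar k G (a * h⁻¹) * uvar k G a ∈ baseImage k G := by
  rw [← fracEquiv_sigma_e]
  exact ⟨_, Algebra.subset_adjoin (Or.inl ⟨_, _, rfl⟩), rfl⟩

theorem sigmaInv_mem_baseImage (g h : G) :
    ∑ c, tvar k G c * (uvar k G (c * g) * uvar k G (c * h)) ∈ baseImage k G := by
  rw [← fracEquiv_sigmaInv_e]
  exact ⟨_, Algebra.subset_adjoin (Or.inr ⟨_, _, rfl⟩), rfl⟩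

/-- The sum is `t_1`, and `σ(1, 1) = t_1 t_1 t⁻¹_1 = t_1`. Expanding `1 = ∑ e_g` gives the triple
sum. -/
theorem sum_tvar_mem_baseImage : ∑ g, tvar k G g ∈ baseImage k G := by
  have h : ∑ g, tvar k G g = ∑ g, ∑ h, ∑ a,
      tvar k G (a * g⁻¹) * tvar k G (a * h⁻¹) * uvar k G a := by
    have hs : ∀ a : G, ∑ g, tvar k G (a * g⁻¹) = ∑ g, tvar k G g := fun a =>
      Fintype.sum_equiv ((Equiv.inv G).trans (Equiv.mulLeft a)) _ _ fun b => by simp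
    calc ∑ g, tvar k G g = (∑ g, tvar k G g) * ((∑ g, tvar k G g) * ∑ a, uvar k G a) := by
          rw [sum_mul_sum_of_convInverse (tvar_uvar k G), mul_one]
      _ = ∑ a, (∑ g, tvar k G (a * g⁻¹)) * (∑ h, tvar k G (a * h⁻¹)) * uvar k G a := by
          simp only [hs]
          rw [← Finset.mul_sum, mul_assoc]
      _ = ∑ a, ∑ g, ∑ h, tvar k G (a * g⁻¹) * tvar k G (a * h⁻¹) * uvar k G a := by
          refine Finset.sum_congr rfl fun a _ => ?_
          rw [Finset.sum_mul_sum]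
          simp only [Finset.sum_mul]
      _ = _ := by
          rw [Finset.sum_comm]
          exact Finset.sum_congr rfl fun g _ => Finset.sum_comm
  rw [h]
  exact sum_mem fun g _ => sum_mem fun h _ => sigma_mem_baseImage k G g h

/-- Likewise `σ⁻¹(1, 1) = t_1 t⁻¹_1 t⁻¹_1 = t⁻¹_1`. -/
theorem sum_uvar_mem_baseImage : ∑ g, uvar k G g ∈ baseImage k G := by
  have h : ∑ g, uvar k G g = ∑ g, ∑ h, ∑ c,
      tvar k G c * (uvar k G (c * g) * uvar k G (c * h)) := by
    have hs : ∀ c : G, ∑ g, uvar k G (c * g) = ∑ g, uvar k G g := fun c =>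
      Fintype.sum_equiv (Equiv.mulLeft c) _ _ fun b => by simp
    calc ∑ g, uvar k G g = ((∑ g, tvar k G g) * (∑ a, uvar k G a)) * ∑ a, uvar k G a := by
          rw [sum_mul_sum_of_convInverse (tvar_uvar k G), one_mul]
      _ = ∑ c, tvar k G c * ((∑ g, uvar k G (c * g)) * (∑ h, uvar k G (c * h))) := by
          simp only [hs]
          rw [← Finset.sum_mul, mul_assoc]
      _ = ∑ c, ∑ g, ∑ h, tvar k G c * (uvar k G (c * g) * uvar k G (c * h)) := by
          refine Finset.sum_congr rfl fun c _ => ?_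
          rw [Finset.sum_mul_sum]
          simp only [Finset.mul_sum]
      _ = _ := by
          rw [Finset.sum_comm]
          exact Finset.sum_congr rfl fun g _ => Finset.sum_comm
  rw [h]
  exact sum_mem fun g _ => sum_mem fun h _ => sigmaInv_mem_baseImage k G g h

/-- `S(t_H)_Θ` is spanned by the `t_g` as a module over the generic base algebra. -/
theorem hopfImage_le_span {x : RatFun k G} (hx : x ∈ hopfImage k G) :
    x ∈ Submodule.span (baseImage k G) (Set.range (tvar k G)) := by
  set W := Submodule.span (baseImage k G) (Set.range (tvar k G)) with hW
  have hsmul : ∀ {b y : RatFun k G}, b ∈ baseImage k G → y ∈ W → b * y ∈ W :=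
    fun {b y} hb hy => W.smul_mem ⟨b, hb⟩ hy
  have ht : ∀ g, tvar k G g ∈ W := fun g => Submodule.subset_span ⟨g, rfl⟩
  have hsu := sum_mul_sum_of_convInverse (tvar_uvar k G)
  have h1 : (1 : RatFun k G) ∈ W := by
    rw [← hsu, mul_comm]
    exact hsmul (sum_uvar_mem_baseImage k G) (sum_mem fun g _ => ht g)
  have hmul : ∀ {y z}, y ∈ W → z ∈ W → y * z ∈ W := by
    intro y z hy hz
    have h2 := Submodule.mul_mem_mul hy hz
    rw [hW, Submodule.span_mul_span] at h2
    refine Submodule.span_le.mpr ?_ h2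
    rintro _ ⟨_, ⟨g, rfl⟩, _, ⟨g', rfl⟩, rfl⟩
    change tvar k G g * tvar k G g' ∈ W
    rw [mul_eq_sum_cocycle (tvar_uvar k G)]
    exact sum_mem fun c _ => hsmul (sigma_mem_baseImage k G _ _) (ht c)
  induction hx using Algebra.adjoin_induction with
  | mem y hy =>
    rcases hy with ⟨g, rfl⟩ | ⟨g, rfl⟩
    · exact ht g
    -- The factor `∑ T` needed to expand `u g` is a unit of `B`, with inverse `∑ u`.
    · have h3 : uvar k G g = (∑ a, uvar k G a) * ((∑ a, tvar k G a) * uvar k G g) := by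
        rw [← mul_assoc, mul_comm (∑ a, uvar k G a), hsu, one_mul]
      rw [h3, sum_mul_eq_sum_cocycleInv (tvar_uvar k G)]
      exact hsmul (sum_uvar_mem_baseImage k G) (sum_mem fun c _ => sum_mem fun b _ =>
        hsmul (sigmaInv_mem_baseImage k G _ _) (ht _))
  | algebraMap r =>
    rw [← mul_one (algebraMap k _ r)]
    exact hsmul ((baseImage k G).algebraMap_mem r) h1
  | add y z _ _ hy hz => exact W.add_mem hy hz
  | mul y z _ _ hy hz => exact hmul hy hz

theorem baseImage_eq_inf :
    baseImage k G = hopfImage k G ⊓ (noetherField k G).toSubalgebra := by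
  refine le_antisymm (le_inf (baseImage_le_hopfImage k G) (baseImage_le_noetherField k G)) ?_
  rintro x ⟨hx, hxG⟩
  obtain ⟨b, hb⟩ := (Submodule.mem_span_range_iff_exists_fun _).mp (hopfImage_le_span k G hx)
  have hxG' := mem_noetherField.mp hxG
  -- Both `x` and the coefficients `b g` are invariant, so `h` only moves the `T g`.
  have hx1 : ∀ h : G, x = ∑ g, (b g : RatFun k G) * tvar k G (h * g) := by
    intro h
    rw [← hxG' h, ← hb, map_sum]
    refine Finset.sum_congr rfl fun g _ => ?_
    rw [Algebra.smul_def, map_mul, noetherAction_tvar]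
    congr 1
    exact mem_noetherField.mp (baseImage_le_noetherField k G (b g).2) h
  have hsu := sum_mul_sum_of_convInverse (tvar_uvar k G)
  have h2 : (∑ a, uvar k G a) * x = b 1 := by
    calc (∑ a, uvar k G a) * x = ∑ a, ∑ g, uvar k G a * ((b g : RatFun k G) * tvar k G (a * g)) := by
          rw [Finset.sum_mul]
          refine Finset.sum_congr rfl fun a _ => ?_
          rw [hx1 a, Finset.mul_sum]
      _ = ∑ g, (b g : RatFun k G) * ∑ a, tvar k G (a * g) * uvar k G a := by
          rw [Finset.sum_comm]
          simp only [Finset.mul_sum]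
          exact Finset.sum_congr rfl fun g _ => Finset.sum_congr rfl fun a _ => by ring
      _ = ∑ g, (b g : RatFun k G) * if g = 1 then 1 else 0 := by
          refine Finset.sum_congr rfl fun g _ => ?_
          have := tvar_uvar k G g⁻¹
          simp only [inv_inv, inv_eq_one] at this
          rw [this]
      _ = b 1 := by simp
  have h3 : x = (∑ a, tvar k G a) * b 1 := by
    rw [← h2, ← mul_assoc, hsu, one_mul]
  rw [h3]
  exact mul_mem (sum_tvar_mem_baseImage k G) (b 1).2

end BaseAlgebra

/-! ### Invariant polynomials and the group determinant -/

section Invariants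

variable (k : Type u) [Field k] (G : Type v) [Fintype G] [DecidableEq G] [Group G]

theorem algebraMap_mem_hopfImage (P : MvPolynomial G k) :
    algebraMap (MvPolynomial G k) (RatFun k G) P ∈ hopfImage k G := by
  induction P using MvPolynomial.induction_on with
  | C r => exact (hopfImage k G).algebraMap_mem r
  | add p q hp hq => rw [map_add]; exact add_mem hp hq
  | mul_X p g hp => rw [map_mul]; exact mul_mem hp (tvar_mem_hopfImage k g)

omit [Fintype G] [DecidableEq G] in
theorem noetherAction_algebraMap (h : G) (P : MvPolynomial G k) :
    noetherAction k G h (algebraMap (MvPolynomial G k) (RatFun k G) P) =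
      algebraMap (MvPolynomial G k) (RatFun k G) (MvPolynomial.rename (fun g => h * g) P) :=
  IsFractionRing.algEquivOfAlgEquiv_algebraMap _ _

omit [Fintype G] [DecidableEq G] in
theorem algebraMap_mem_noetherField {P : MvPolynomial G k} :
    algebraMap (MvPolynomial G k) (RatFun k G) P ∈ noetherField k G ↔ P ∈ invPoly k G := by
  rw [mem_noetherField]
  refine forall_congr' fun h => ?_
  rw [noetherAction_algebraMap]
  exact (IsFractionRing.injective (MvPolynomial G k) (RatFun k G)).eq_iff

/-- The transpose of the matrix defining the group determinant. -/
def groupMatrix : Matrix G G (MvPolynomial G k) := Matrix.of fun g a => MvPolynomial.X (a * g⁻¹)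

theorem det_groupMatrix : (groupMatrix k G).det = groupDet k G :=
  Matrix.det_transpose (Matrix.of fun g h : G => (MvPolynomial.X (g * h⁻¹) : MvPolynomial G k))

omit [Fintype G] [DecidableEq G] in
theorem groupMatrix_map : (groupMatrix k G).map (algebraMap _ (RatFun k G)) =
    Matrix.of fun g a : G => tvar k G (a * g⁻¹) := rfl

theorem det_tvar : (Matrix.of fun g a : G => tvar k G (a * g⁻¹)).det =
    algebraMap _ (RatFun k G) (groupDet k G) := by
  rw [← det_groupMatrix, RingHom.map_det]
  rfl

theorem algebraMap_groupDet_ne_zero : algebraMap _ (RatFun k G) (groupDet k G) ≠ 0 :=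
  (map_ne_zero_iff _ (IsFractionRing.injective (MvPolynomial G k) (RatFun k G))).mpr
    (groupDet_ne_zero k G)

/-- The inverse of `Θ` is the determinant of the inverse matrix, whose entries are values of `u`. -/
theorem inv_groupDet_mem_hopfImage :
    (algebraMap _ (RatFun k G) (groupDet k G))⁻¹ ∈ hopfImage k G := by
  have h := congrArg Matrix.det (mul_eq_one_of_convInverse (tvar_uvar k G))
  rw [Matrix.det_mul, Matrix.det_one, det_tvar] at h
  rw [← eq_inv_of_mul_eq_one_right h]
  have h1 := AlgHom.map_det (hopfImage k G).val
    (Matrix.of fun a g : G => (⟨uvar k G (a * g⁻¹), uvar_mem_hopfImage k _⟩ : hopfImage k G))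
  exact h1 ▸ SetLike.coe_mem _

/-- Cramer's rule: the vector `u` solves a linear system with determinant `Θ` and right-hand side
the unit vector at `1`. -/
theorem groupDet_mul_uvar (a : G) :
    algebraMap _ (RatFun k G) (groupDet k G) * uvar k G a =
      algebraMap _ (RatFun k G) ((groupMatrix k G).adjugate a 1) := by
  have h1 : (Matrix.of fun g a : G => tvar k G (a * g⁻¹)).mulVec (uvar k G) = Pi.single 1 1 := by
    ext g
    rw [Pi.single_apply]
    exact tvar_uvar k G g
  have h2 := congrArg
    (Matrix.mulVec (Matrix.of fun g a : G => tvar k G (a * g⁻¹)).adjugate) h1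
  rw [Matrix.mulVec_mulVec, Matrix.adjugate_mul, det_tvar, Matrix.smul_mulVec,
    Matrix.one_mulVec, Matrix.mulVec_single_one] at h2
  have h3 := congrFun h2 a
  rw [Pi.smul_apply, smul_eq_mul] at h3
  rw [h3, ← groupMatrix_map]
  have h4 := RingHom.map_adjugate (algebraMap (MvPolynomial G k) (RatFun k G)) (groupMatrix k G)
  exact (congrFun (congrFun h4 a) 1).symm

theorem exists_mul_groupDet_pow {x : RatFun k G} (hx : x ∈ hopfImage k G) :
    ∃ (n : ℕ) (P : MvPolynomial G k),
      x * algebraMap _ (RatFun k G) (groupDet k G) ^ n = algebraMap _ (RatFun k G) P := by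
  induction hx using Algebra.adjoin_induction with
  | mem y hy =>
    rcases hy with ⟨g, rfl⟩ | ⟨g, rfl⟩
    · exact ⟨0, MvPolynomial.X g, by simp [tvar]⟩
    · exact ⟨1, _, by rw [pow_one, mul_comm]; exact groupDet_mul_uvar k G g⟩
  | algebraMap r => exact ⟨0, MvPolynomial.C r, by rw [pow_zero, mul_one]; rfl⟩
  | add y z _ _ hy hz =>
    obtain ⟨n, P, hP⟩ := hy
    obtain ⟨m, Q, hQ⟩ := hz
    refine ⟨n + m, P * groupDet k G ^ m + Q * groupDet k G ^ n, ?_⟩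
    simp only [map_add, map_mul, map_pow, ← hP, ← hQ]
    ring
  | mul y z _ _ hy hz =>
    obtain ⟨n, P, hP⟩ := hy
    obtain ⟨m, Q, hQ⟩ := hz
    refine ⟨n + m, P * Q, ?_⟩
    simp only [map_mul, ← hP, ← hQ]
    ring

theorem invPolyLoc_eq_inf :
    invPolyLoc k G = hopfImage k G ⊓ (noetherField k G).toSubalgebra := by
  have hsq := (algebraMap_mem_noetherField k G).mpr (groupDet_sq_mem_invPoly k G)
  refine le_antisymm ?_ ?_
  · rw [invPolyLoc, Algebra.adjoin_le_iff]
    rintro _ (⟨P, hP, rfl⟩ | rfl)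
    · exact ⟨algebraMap_mem_hopfImage k G P, (algebraMap_mem_noetherField k G).mpr hP⟩
    · refine ⟨?_, (noetherField k G).inv_mem hsq⟩
      rw [map_pow, ← inv_pow]
      exact pow_mem (inv_groupDet_mem_hopfImage k G) 2
  · rintro x ⟨hx, hxG⟩
    obtain ⟨n, P, hP⟩ := exists_mul_groupDet_pow k G hx
    have h0 : algebraMap _ (RatFun k G) (groupDet k G ^ 2) ^ n ≠ 0 := by
      rw [map_pow]
      exact pow_ne_zero _ (pow_ne_zero _ (algebraMap_groupDet_ne_zero k G))
    -- The exponent is doubled because `Θ` itself is invariant only up to sign; with the denominator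
    -- `Θ ^ (2 * n)` the numerator becomes invariant.
    have h1 : x * algebraMap _ (RatFun k G) (groupDet k G ^ 2) ^ n =
        algebraMap _ (RatFun k G) (P * groupDet k G ^ n) := by
      rw [map_mul, ← hP, map_pow, map_pow]
      ring
    have h2 : P * groupDet k G ^ n ∈ invPoly k G := by
      rw [← algebraMap_mem_noetherField, ← h1]
      exact mul_mem hxG (pow_mem hsq n)
    have h3 : (algebraMap _ (RatFun k G) (groupDet k G ^ 2))⁻¹ ∈ invPolyLoc k G :=
      Algebra.subset_adjoin (Set.mem_union_right _ (Set.mem_singleton _))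
    rw [(eq_mul_inv_iff_mul_eq₀ h0).mpr h1, ← inv_pow]
    exact mul_mem (Algebra.subset_adjoin (Or.inl ⟨_, h2, rfl⟩)) (pow_mem h3 n)

theorem map_baseAlgebra_eq_invPolyLoc :
    (baseAlgebra k (FunHopf k G)).map (fracEquiv k G : _ →ₐ[k] RatFun k G) = invPolyLoc k G :=
  (baseImage_eq_inf k G).trans (invPolyLoc_eq_inf k G).symm

/-- Every invariant rational function is a quotient of elements of the generic base algebra. -/
theorem exists_mul_mem_baseImage {x : RatFun k G} (hx : x ∈ noetherField k G) :
    ∃ y ∈ baseImage k G, y ≠ 0 ∧ x * y ∈ baseImage k G := by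
  obtain ⟨P, Q, hQ, rfl⟩ := IsFractionRing.div_surjective (MvPolynomial G k) x
  have hQ0 : Q ≠ 0 := nonZeroDivisors.ne_zero hQ
  -- The norm of the denominator: an invariant polynomial, divisible by `Q` through its factor at `h
  -- = 1`.
  let N : MvPolynomial G k := ∏ h : G, MvPolynomial.rename (fun g => h * g) Q
  have hN : N ∈ invPoly k G := by
    intro b
    rw [map_prod]
    exact Fintype.prod_equiv (Equiv.mulLeft b) _ _ fun h => by
      rw [MvPolynomial.rename_rename]
      simp [Function.comp_def, mul_assoc]
  have hN0 : N ≠ 0 := Finset.prod_ne_zero_iff.mpr fun h _ =>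
    (map_ne_zero_iff _ (MvPolynomial.rename_injective _ (mul_right_injective h))).mpr hQ0
  have hQN : Q ∣ N := by
    have := Finset.dvd_prod_of_mem (fun h : G => MvPolynomial.rename (fun g => h * g) Q)
      (Finset.mem_univ 1)
    simp only [one_mul] at this
    rwa [show MvPolynomial.rename (fun g : G => g) Q = Q from MvPolynomial.rename_id_apply Q] at this
  have hNB := (algebraMap_mem_noetherField k G).mpr hN
  have inj := IsFractionRing.injective (MvPolynomial G k) (RatFun k G)
  refine ⟨algebraMap _ _ N, ?_, (map_ne_zero_iff _ inj).mpr hN0, ?_⟩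
  · rw [baseImage_eq_inf]
    exact ⟨algebraMap_mem_hopfImage k G N, hNB⟩
  · rw [baseImage_eq_inf]
    refine ⟨?_, mul_mem hx hNB⟩
    obtain ⟨R, hR⟩ := hQN
    have hQ1 := (map_ne_zero_iff _ inj).mpr hQ0
    rw [hR, map_mul, ← mul_assoc, div_mul_cancel₀ _ hQ1, ← map_mul]
    exact algebraMap_mem_hopfImage k G _

end Invariants

/-! ### From localizations of polynomial algebras to pure transcendence -/

/-- A field is purely transcendental over `k` if it is generated, as a field, by a localization of
a polynomial algebra over `k`. -/
theorem isPurelyTranscendental_of_localization {k L : Type*} [Field k] [Field L] [Algebra k L]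
    {n : ℕ} (M : Submonoid (MvPolynomial (Fin n) k)) (j : Localization M →ₐ[k] L)
    (hj : Function.Injective j)
    (hL : ∀ x : L, ∃ y ∈ j.range, y ≠ 0 ∧ x * y ∈ j.range) : IsPurelyTranscendental k L := by
  let f : MvPolynomial (Fin n) k →ₐ[k] L :=
    j.comp (Algebra.algHom k (MvPolynomial (Fin n) k) (Localization M))
  have : Nontrivial (Localization M) := j.toRingHom.domain_nontrivial
  -- An arbitrary `M` might contain `0`; the map `j` to a field excludes this, so the polynomial
  -- algebra embeds in its localization.
  have hM0 : (0 : MvPolynomial (Fin n) k) ∉ M := fun h0 =>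
    not_subsingleton _ (IsLocalization.subsingleton (S := Localization M) h0)
  have hf : Function.Injective f :=
    hj.comp (IsLocalization.injective (Localization M) (le_nonZeroDivisors_of_noZeroDivisors hM0))
  have hfX : MvPolynomial.aeval (fun i => f (MvPolynomial.X i)) = f :=
    MvPolynomial.algHom_ext fun i => by simp
  have hind : AlgebraicIndependent k fun i => f (MvPolynomial.X i) := by
    rw [algebraicIndependent_iff_injective_aeval, hfX]
    exact hf
  refine ⟨_, hind.coe_range, ?_⟩
  set F := IntermediateField.adjoin k (Set.range fun i => f (MvPolynomial.X i)) with hF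
  have hfF : ∀ p, f p ∈ F := by
    intro p
    rw [← hfX]
    induction p using MvPolynomial.induction_on with
    | C r => rw [MvPolynomial.aeval_C]; exact F.algebraMap_mem r
    | add p q hp hq => rw [map_add]; exact add_mem hp hq
    | mul_X p i hp =>
      rw [map_mul, MvPolynomial.aeval_X]
      exact mul_mem hp (IntermediateField.subset_adjoin k _ ⟨i, rfl⟩)
  have hjF : ∀ y ∈ j.range, y ∈ F := by
    rintro _ ⟨z, rfl⟩
    obtain ⟨p, m, hz⟩ := IsLocalization.exists_mk'_eq M z
    have h1 := congrArg j ((IsLocalization.mk'_spec (Localization M) p m))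
    rw [map_mul, hz] at h1
    have h2 : j z * f m = f p := h1
    have h3 : f m ≠ 0 := (map_ne_zero_iff _ hf).mpr fun h0 => hM0 (h0 ▸ m.2)
    change j z ∈ F
    rw [(eq_mul_inv_iff_mul_eq₀ h3).mpr h2]
    exact mul_mem (hfF p) (inv_mem (hfF m))
  refine eq_top_iff.mpr fun x _ => ?_
  obtain ⟨y, hy, hy0, hxy⟩ := hL x
  rw [← mul_inv_cancel_right₀ hy0 x]
  exact mul_mem (hjF _ hxy) (inv_mem (hjF _ hy))

theorem noetherPositive_of_gnpPositive (k : Type u) [Field k] (G : Type v) [Fintype G]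
    [DecidableEq G] [Group G] (h : GNPPositive k (FunHopf k G)) : NoetherPositive k G := by
  obtain ⟨n, M, ⟨e⟩⟩ := h
  -- The target is cut down to the field of invariants, so that the generation hypothesis concerns
  -- that field and not all of `k(t_g | g ∈ G)`.
  let i : baseAlgebra k (FunHopf k G) →ₐ[k] noetherField k G :=
    ((fracEquiv k G : _ →ₐ[k] RatFun k G).comp (baseAlgebra k (FunHopf k G)).val).codRestrict
      (noetherField k G).toSubalgebra
      fun x => baseImage_le_noetherField k G ⟨x, x.2, rfl⟩
  have hi : Function.Injective i := fun x y hxy =>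
    Subtype.ext ((fracEquiv k G).injective (congrArg Subtype.val hxy))
  have hrange : ∀ z : noetherField k G, (z : RatFun k G) ∈ baseImage k G →
      z ∈ (i.comp e.toAlgHom).range := by
    rintro z ⟨w, hw, hwz⟩
    refine ⟨e.symm ⟨w, hw⟩, Subtype.ext ?_⟩
    change fracEquiv k G (e (e.symm ⟨w, hw⟩) : FracSym k (FunHopf k G)) = z
    rw [e.apply_symm_apply, ← hwz]
    rfl
  refine isPurelyTranscendental_of_localization M (i.comp e.toAlgHom)
    (hi.comp (e.injective)) fun x => ?_
  obtain ⟨y, hy, hy0, hxy⟩ := exists_mul_mem_baseImage k G x.2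
  exact ⟨⟨y, baseImage_le_noetherField k G hy⟩, hrange _ hy,
    fun h0 => hy0 (congrArg Subtype.val h0), hrange _ hxy⟩

end

end GenNoether

theorem proposition4p1 (k : Type*) [Field k] (G : Type*) [Group G] [Fintype G] [DecidableEq G] :
    (∃ ψ : GenNoether.FracSym k (GenNoether.FunHopf k G) ≃ₐ[k] GenNoether.RatFun k G,
      (∀ g : G, ψ (GenNoether.t k (GenNoether.FunHopf k G) (GenNoether.FunHopf.e k g⁻¹)) =
        GenNoether.tvar k G g) ∧
      (GenNoether.baseAlgebra k (GenNoether.FunHopf k G)).map (ψ : _ →ₐ[k] _) =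
        GenNoether.invPolyLoc k G) ∧
    (GenNoether.GNPPositive k (GenNoether.FunHopf k G) → GenNoether.NoetherPositive k G) := by
  refine ⟨⟨GenNoether.fracEquiv k G, fun g => ?_, GenNoether.map_baseAlgebra_eq_invPolyLoc k G⟩,
    GenNoether.noetherPositive_of_gnpPositive k G⟩
  rw [GenNoether.fracEquiv_t_e, inv_inv]
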